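/- Let $f:\mathbb{R}^d\to\mathbb{R}$ be differentiable with $L$-Lipschitz gradient for the Euclidean norm, i.e. $\|\nabla f(x)-\nabla f(y)\|_2\le L\|x-y\|_2$ for all $x,y$. Suppose that $f$ attains its infimum at a point $\theta^*$, that $f$ is convex, i.e. $f(y)\ge f(x)+\langle\nabla f(x),y-x\rangle$ for all $x,y$, and that some sublevel set $\{x : f(x)\le f(c)\}$, $c\in\mathbb{R}^d$, is bounded. Let $\mathcal{D}$ be a probability distribution on $\mathbb{R}^d$ such that $\mathbb{E}_{s\sim\mathcal{D}}\|s\|_2^2<\infty$, such that $\|s\|_2\le 1$ for $\mathcal{D}$-almost every $s$, and such that there are a norm $\|\cdot\|_{\mathcal{D}}$ on $\mathbb{R}^d$ and a constant $\mu_{\mathcal{D}}>0$ with $\mathbb{E}_{s\sim\mathcal{D}}|\langle v,s\rangle|\ge\mu_{\mathcal{D}}\|v\|_{\mathcal{D}}$ for all $v\in\mathbb{R}^d$. Let $\{\theta^t\}_{t\ge1}$ be generated by the stochastic three points (STP) algorithm: $\theta^1\in\mathbb{R}^d$ is given and, for $t=1,2,\dots$, a random vector $s_t\sim\mathcal{D}$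 is drawn independently of the past (that is, of $\theta^1,\dots,\theta^t,s_1,\dots,s_{t-1}$) and $$\theta^{t+1}\in\operatorname*{arg\,min}_{\theta\in\{\theta^t,\ \theta^t+\alpha_ts_t,\ \theta^t-\alpha_ts_t\}}f(\theta),$$ ties being broken in any measurable way that does not anticipate later directions. Suppose that the step sizes $\alpha_t>0$ are of exact order $1/t^{1-\beta}$ for some $\beta\in(0,\tfrac12)$, i.e. $\alpha_t=\Theta(1/t^{1-\beta})$: there are constants $0<a\le b$ with $a/t^{1-\beta}\le\alpha_t\le b/t^{1-\beta}$ for all sufficiently large $t$. Then for every $\epsilon\in(2\beta,1)$, almost surely, $$f(\theta^T)-f(\theta^*)=o\!\left(\frac{1}{T^{1-\epsilon}}\right)\qquad (T\to\infty).$$ -/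

import Mathlib

open MeasureTheory ProbabilityTheory Filter Asymptotics

/-- `f` is differentiable and its gradient is `L`-Lipschitz for the Euclidean norm. -/
def IsLSmooth {d : ℕ} (L : ℝ) (f : EuclideanSpace ℝ (Fin d) → ℝ) : Prop :=
  Differentiable ℝ f ∧ ∀ x y, ‖gradient f x - gradient f y‖ ≤ L * ‖x - y‖

/-- First-order convexity of a differentiable function. -/
def IsGradConvex {d : ℕ} (f : EuclideanSpace ℝ (Fin d) → ℝ) : Prop :=
  ∀ x y, f x + inner ℝ (gradient f x) (y - x) ≤ f y

/-- A seminorm that vanishes only at `0`, i.e. an arbitrary norm on `ℝ^d`. -/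
def IsNorm {d : ℕ} (p : Seminorm ℝ (EuclideanSpace ℝ (Fin d))) : Prop :=
  ∀ v, p v = 0 → v = 0

/-- The three points compared by one step of the algorithm: the current point `x` and the points
`x + a s`, `x - a s`. -/
def stpCandidates {d : ℕ} (x : EuclideanSpace ℝ (Fin d)) (a : ℝ)
    (s : EuclideanSpace ℝ (Fin d)) : Set (EuclideanSpace ℝ (Fin d)) :=
  {x, x + a • s, x - a • s}

/-- `θ` is a sequence generated by the stochastic three points algorithm for the objective `f`,
from the initial point `θ₁`, with step sizes `α t` and search directions `s t` drawn from `D`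
(indices start at `t = 1`; values at index `0` play no role).
The σ-algebra `ℱ t` is the information available when `s t` is drawn: it contains
`θ 1, …, θ t` and `s 1, …, s (t - 1)`, and the new direction `s t` is independent of it. A minimiser
among the three candidates need not be unique; any (measurable) choice is allowed, even a
randomised one, as long as it does not anticipate the directions drawn later. -/
structure IsSTP {d : ℕ} {Ω : Type*} [mΩ : MeasurableSpace Ω] (P : Measure Ω)
    (ℱ : Filtration ℕ mΩ)
    (f : EuclideanSpace ℝ (Fin d) → ℝ) (θ₁ : EuclideanSpace ℝ (Fin d)) (α : ℕ → ℝ)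
    (D : Measure (EuclideanSpace ℝ (Fin d)))
    (s θ : ℕ → Ω → EuclideanSpace ℝ (Fin d)) : Prop where
  step_pos : ∀ t, 1 ≤ t → 0 < α t
  init : ∀ ω, θ 1 ω = θ₁
  measurable_point : ∀ t, 1 ≤ t → Measurable[ℱ t] (θ t)
  measurable_dir : ∀ t, 1 ≤ t → Measurable[ℱ (t + 1)] (s t)
  law_dir : ∀ t, 1 ≤ t → P.map (s t) = D
  indep_dir : ∀ t, 1 ≤ t → Indep (MeasurableSpace.comap (s t) inferInstance) (ℱ t) P
  step_mem : ∀ t, 1 ≤ t → ∀ ω, θ (t + 1) ω ∈ stpCandidates (θ t ω) (α t) (s t ω)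
  step_min : ∀ t, 1 ≤ t → ∀ ω, ∀ y ∈ stpCandidates (θ t ω) (α t) (s t ω), f (θ (t + 1) ω) ≤ f y

/-! Write `g = ∇f(θ^t)`. The better of the two signs gives `f(θ^{t+1}) ≤ f(θ^t) - α_t |⟨g, s_t⟩| +
|L| α_t²`. Since `s_t` is independent of `θ^t`, the mean of `|⟨g, s_t⟩|` is at least `c E‖g‖`. The
values never increase, so the iterates stay in a sublevel set, which lies in a ball of radius `R`
about `θ*`; convexity then bounds the gap by `R‖g‖`. Hence the mean gap satisfies `e_{t+1} ≤ (1 - κ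
α_t) e_t + |L| α_t²` with `κ = c / R`, and `e_t = O(t^{-(1-β)})`
(`exists_le_mul_rpow_of_recursion`). To pass to almost sure rates, weight the gap at times `2^k` by
`2^{k(1-ε)}`: the means are summable, so these terms tend to `0` almost surely, and monotonicity of
the gap fills in the other times. -/

/-! ### Norms and sublevel sets -/

/-- Every norm on `ℝ^d` dominates a multiple of the Euclidean norm. -/
theorem IsNorm.exists_mul_norm_le {d : ℕ} {p : Seminorm ℝ (EuclideanSpace ℝ (Fin d))}
    (hp : IsNorm p) : ∃ c : ℝ, 0 < c ∧ ∀ v, c * ‖v‖ ≤ p v := by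
  have hcont : Continuous p := p.convexOn.locallyLipschitz.continuous
  have hpos : ∀ v, v ≠ 0 → 0 < p v := fun v hv =>
    lt_of_le_of_ne (apply_nonneg p v) fun h => hv (hp v h.symm)
  -- The sphere is empty when `d = 0`; otherwise the constant is the minimum of `p` on it.
  obtain hs | hs := (Metric.sphere (0 : EuclideanSpace ℝ (Fin d)) 1).eq_empty_or_nonempty
  · refine ⟨1, one_pos, fun v => ?_⟩
    obtain rfl | hv := eq_or_ne v 0
    · simp
    · have : ‖v‖⁻¹ • v ∈ Metric.sphere (0 : EuclideanSpace ℝ (Fin d)) 1 := by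
        simp [norm_smul, hv]
      simp [hs] at this
  · obtain ⟨u, hu, hmin⟩ := (isCompact_sphere _ _).exists_isMinOn hs hcont.continuousOn
    refine ⟨p u, hpos u ?_, fun v => ?_⟩
    · rintro rfl
      simp at hu
    obtain rfl | hv := eq_or_ne v 0
    · simp
    have hv' : 0 < ‖v‖ := norm_pos_iff.2 hv
    have h1 : ‖v‖⁻¹ • v ∈ Metric.sphere (0 : EuclideanSpace ℝ (Fin d)) 1 := by
      simp [norm_smul, hv]
    have h2 : p u ≤ p (‖v‖⁻¹ • v) := hmin h1
    rw [map_smul_eq_mul, norm_inv, norm_norm, inv_mul_eq_div, le_div_iff₀ hv'] at h2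
    exact h2

/-- First-order convexity implies Jensen's inequality on segments. -/
theorem IsGradConvex.le_on_segment {d : ℕ} {f : EuclideanSpace ℝ (Fin d) → ℝ}
    (hf : IsGradConvex f) (x y : EuclideanSpace ℝ (Fin d)) {l : ℝ} (h0 : 0 ≤ l) (h1 : l ≤ 1) :
    f (x + l • (y - x)) ≤ f x + l * (f y - f x) := by
  have hx := hf (x + l • (y - x)) x
  have hy := hf (x + l • (y - x)) y
  rw [show x - (x + l • (y - x)) = (-l) • (y - x) by module, real_inner_smul_right] at hx
  rw [show y - (x + l • (y - x)) = (1 - l) • (y - x) by module, real_inner_smul_right] at hy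
  -- With weights `1 - l` and `l` the two gradient terms cancel.
  nlinarith [mul_le_mul_of_nonneg_left hx (sub_nonneg.2 h1), mul_le_mul_of_nonneg_left hy h0]

/-- If a convex function with a minimiser has one bounded sublevel set, all of its sublevel sets
are bounded. -/
theorem IsGradConvex.exists_norm_sub_le {d : ℕ} {f : EuclideanSpace ℝ (Fin d) → ℝ}
    (hf : IsGradConvex f) (hcont : Continuous f) {x₀ : EuclideanSpace ℝ (Fin d)}
    (hmin : ∀ x, f x₀ ≤ f x) (hsub : ∃ c, Bornology.IsBounded {x | f x ≤ f c}) (C : ℝ) :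
    ∃ R : ℝ, 0 < R ∧ ∀ x, f x ≤ C → ‖x - x₀‖ ≤ R := by
  obtain ⟨c, hc⟩ := hsub
  obtain ⟨r, hr0, hr⟩ := hc.subset_closedBall_lt 0 x₀
  -- Strictly larger than `r`, so that `f > f c` on the sphere of radius `ρ`.
  set ρ := r + 1
  have hρ : 0 < ρ := by positivity
  have hproj : ∀ x, ρ < ‖x - x₀‖ →
      x₀ + (ρ / ‖x - x₀‖) • (x - x₀) ∈ Metric.sphere x₀ ρ := by
    intro x hx
    have : 0 < ‖x - x₀‖ := hρ.trans hx
    rw [mem_sphere_iff_norm, add_sub_cancel_left, norm_smul, Real.norm_of_nonneg (by positivity),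
      div_mul_cancel₀ _ this.ne']
  obtain hs | hs := (Metric.sphere x₀ ρ).eq_empty_or_nonempty
  · refine ⟨ρ, hρ, fun x _ => le_of_not_gt fun hx => ?_⟩
    simpa [hs] using hproj x hx
  obtain ⟨u, hu, humin⟩ := (isCompact_sphere _ _).exists_isMinOn hs hcont.continuousOn
  have hgap : f x₀ < f u := by
    refine (hmin c).trans_lt (lt_of_not_ge fun h => ?_)
    have h1 := hr h
    rw [mem_closedBall_iff_norm] at h1
    rw [mem_sphere_iff_norm] at hu
    linarith
  -- Beyond the sphere, convexity forces `f - f x₀` to grow at least linearly, with slope `(f u - f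
  -- x₀) / ρ`.
  refine ⟨max ρ (ρ * (C - f x₀) / (f u - f x₀)), lt_max_of_lt_left hρ, fun x hx => ?_⟩
  obtain hle | hlt := le_or_gt ‖x - x₀‖ ρ
  · exact le_max_of_le_left hle
  refine le_max_of_le_right ?_
  have hn : 0 < ‖x - x₀‖ := hρ.trans hlt
  have h1 : f u ≤ f (x₀ + (ρ / ‖x - x₀‖) • (x - x₀)) := humin (hproj x hlt)
  have h2 := hf.le_on_segment x₀ x (l := ρ / ‖x - x₀‖) (by positivity)
    ((div_le_one hn).2 hlt.le)
  rw [le_div_iff₀ (sub_pos.2 hgap)]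
  have h3 : f u - f x₀ ≤ ρ * (f x - f x₀) / ‖x - x₀‖ := by
    rw [mul_div_right_comm]; linarith
  rw [le_div_iff₀ hn] at h3
  nlinarith

/-! ### One-step descent, pathwise and in mean -/

/-- The descent inequality, for a convex function with Lipschitz gradient. -/
theorem IsLSmooth.le_add_inner {d : ℕ} {L : ℝ} {f : EuclideanSpace ℝ (Fin d) → ℝ}
    (hf : IsLSmooth L f) (hconv : IsGradConvex f) (x h : EuclideanSpace ℝ (Fin d)) :
    f (x + h) ≤ f x + inner ℝ (gradient f x) h + |L| * ‖h‖ ^ 2 := by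
  -- Convexity at `x + h` replaces integration along the segment, at the cost of `|L|` in place of
  -- `L / 2`.
  have h1 := hconv (x + h) x
  rw [show x - (x + h) = -h by abel, inner_neg_right] at h1
  have h2 : inner ℝ (gradient f (x + h) - gradient f x) h ≤ |L| * ‖h‖ ^ 2 := by
    refine (real_inner_le_norm _ _).trans ?_
    have h3 := hf.2 (x + h) x
    rw [add_sub_cancel_left] at h3
    have h4 : L * ‖h‖ ≤ |L| * ‖h‖ := by gcongr; exact le_abs_self L
    nlinarith [norm_nonneg h]
  rw [inner_sub_left] at h2
  linarith

theorem IsLSmooth.continuous_gradient {d : ℕ} {L : ℝ} {f : EuclideanSpace ℝ (Fin d) → ℝ}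
    (hf : IsLSmooth L f) : Continuous (gradient f) := by
  refine (LipschitzWith.of_dist_le_mul (K := ⟨|L|, abs_nonneg L⟩) fun x y => ?_).continuous
  rw [dist_eq_norm, dist_eq_norm]
  exact (hf.2 x y).trans (by gcongr; exact le_abs_self L)

/-- Any best candidate of a step decreases `f` by a multiple of the directional derivative, up to a
second-order term. -/
theorem IsLSmooth.stp_descent {d : ℕ} {L : ℝ} {f : EuclideanSpace ℝ (Fin d) → ℝ}
    (hf : IsLSmooth L f) (hconv : IsGradConvex f) {x s x' : EuclideanSpace ℝ (Fin d)} {a : ℝ}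
    (ha : 0 ≤ a) (hs : ‖s‖ ≤ 1) (hx' : ∀ y ∈ stpCandidates x a s, f x' ≤ f y) :
    f x' ≤ f x - a * |inner ℝ (gradient f x) s| + |L| * a ^ 2 := by
  have hsq : |L| * ‖a • s‖ ^ 2 ≤ |L| * a ^ 2 := by
    rw [norm_smul, Real.norm_of_nonneg ha]
    gcongr
    exact mul_le_of_le_one_right ha hs
  have h1 := (hx' (x + a • s) (by simp [stpCandidates])).trans (hf.le_add_inner hconv x (a • s))
  have h2 : f x' ≤ f x + inner ℝ (gradient f x) (-(a • s)) + |L| * ‖-(a • s)‖ ^ 2 := by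
    refine (hx' (x - a • s) (by simp [stpCandidates])).trans ?_
    rw [sub_eq_add_neg]
    exact hf.le_add_inner hconv x _
  rw [real_inner_smul_right] at h1
  rw [inner_neg_right, real_inner_smul_right, norm_neg] at h2
  rcases abs_cases (inner ℝ (gradient f x) s) with ⟨h, -⟩ | ⟨h, -⟩ <;> rw [h] <;> linarith

/-- If `X` is bounded and independent of `S ∼ D`, a lower bound on the mean of `|⟪v, S⟫|` that is
uniform in `v` can be integrated over `v = X`. -/
theorem mul_integral_norm_le_integral_abs_inner {d : ℕ} {Ω : Type*} [MeasurableSpace Ω]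
    {P : Measure Ω} [IsProbabilityMeasure P] {D : Measure (EuclideanSpace ℝ (Fin d))}
    [IsProbabilityMeasure D] (hD : ∀ᵐ s ∂D, ‖s‖ ≤ 1) {c : ℝ}
    (hc : ∀ v : EuclideanSpace ℝ (Fin d), c * ‖v‖ ≤ ∫ s, |inner ℝ v s| ∂D)
    {X S : Ω → EuclideanSpace ℝ (Fin d)} (hX : Measurable X) (hS : Measurable S)
    (hSD : P.map S = D) (hind : IndepFun X S P) {B : ℝ} (hB : ∀ ω, ‖X ω‖ ≤ B) :
    Integrable (fun ω => |inner ℝ (X ω) (S ω)|) P ∧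
      c * ∫ ω, ‖X ω‖ ∂P ≤ ∫ ω, |inner ℝ (X ω) (S ω)| ∂P := by
  have hS1 : ∀ᵐ ω ∂P, ‖S ω‖ ≤ 1 := ae_of_ae_map hS.aemeasurable (hSD ▸ hD)
  have hint : Integrable (fun ω => |inner ℝ (X ω) (S ω)|) P := by
    refine Integrable.of_bound (C := B) (by fun_prop) ?_
    filter_upwards [hS1] with ω hω
    rw [Real.norm_eq_abs, abs_abs]
    have h1 := abs_real_inner_le_norm (X ω) (S ω)
    nlinarith [hB ω, norm_nonneg (X ω), norm_nonneg (S ω)]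
  refine ⟨hint, ?_⟩
  -- By independence the joint law is a product, so Fubini lets the bound `hc` apply for each fixed
  -- value of `X`.
  have hprod : P.map (fun ω => (X ω, S ω)) = (P.map X).prod D := by
    rw [← hSD]
    exact (indepFun_iff_map_prod_eq_prod_map_map hX.aemeasurable hS.aemeasurable).1 hind
  have hφ : Measurable fun z : EuclideanSpace ℝ (Fin d) × EuclideanSpace ℝ (Fin d) =>
      |(inner ℝ z.1 z.2 : ℝ)| := by fun_prop
  have := Measure.isProbabilityMeasure_map (μ := P) hX.aemeasurable
  have hint' : Integrable (fun z : EuclideanSpace ℝ (Fin d) × EuclideanSpace ℝ (Fin d) =>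
      |(inner ℝ z.1 z.2 : ℝ)|) ((P.map X).prod D) := by
    rw [← hprod]
    exact (integrable_map_measure hφ.aestronglyMeasurable (hX.prodMk hS).aemeasurable).2 hint
  have heq : ∫ ω, |inner ℝ (X ω) (S ω)| ∂P = ∫ x, ∫ s, |inner ℝ x s| ∂D ∂(P.map X) := by
    rw [← integral_prod _ hint', ← hprod]
    exact (integral_map (hX.prodMk hS).aemeasurable hφ.aestronglyMeasurable).symm
  have hn : Integrable (fun x : EuclideanSpace ℝ (Fin d) => ‖x‖) (P.map X) := by
    refine (integrable_map_measure (by fun_prop) hX.aemeasurable).2 ?_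
    exact Integrable.of_bound (C := B) (by fun_prop) (ae_of_all _ fun ω => by simpa using hB ω)
  rw [heq, ← integral_const_mul, ← integral_map (f := fun x => c * ‖x‖) hX.aemeasurable
    (by fun_prop)]
  exact integral_mono (hn.const_mul c) hint'.integral_prod_left hc

/-! ### The recursion for the mean gap -/

/-- A sequence with `e (t + 1) ≤ (1 - κ α t) e t + C (α t) ^ 2` and `α t` of exact order `t ^ (-γ)`,
`0 ≤ γ < 1`, decays like `t ^ (-γ)`. -/
theorem exists_le_mul_rpow_of_recursion {e α : ℕ → ℝ} {κ C a b γ : ℝ} (hκ : 0 < κ) (hC : 0 ≤ C)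
    (ha : 0 < a) (hγ0 : 0 < γ) (hγ1 : γ < 1) (he : ∀ t, 0 ≤ e t)
    (hα : ∀ᶠ t : ℕ in atTop, a * (t : ℝ) ^ (-γ) ≤ α t ∧ α t ≤ b * (t : ℝ) ^ (-γ))
    (hrec : ∀ᶠ t in atTop, e (t + 1) ≤ (1 - κ * α t) * e t + C * α t ^ 2) :
    ∃ K, ∀ᶠ t : ℕ in atTop, e t ≤ K * (t : ℝ) ^ (-γ) := by
  have hlim : Tendsto (fun t : ℕ => (t : ℝ) ^ (-(1 - γ))) atTop (nhds 0) :=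
    (tendsto_rpow_neg_atTop (sub_pos.2 hγ1)).comp tendsto_natCast_atTop_atTop
  have hlim' : Tendsto (fun t : ℕ => κ * a * (t : ℝ) ^ (-γ)) atTop (nhds (κ * a * 0)) :=
    ((tendsto_rpow_neg_atTop hγ0).comp tendsto_natCast_atTop_atTop).const_mul _
  rw [mul_zero] at hlim'
  obtain ⟨t₀, ht₀⟩ := eventually_atTop.1 (hα.and (hrec.and
    ((hlim.eventually (gt_mem_nhds (show 0 < κ * a / 2 by positivity))).and
      ((hlim'.eventually (gt_mem_nhds one_pos)).and (eventually_ge_atTop 1)))))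
  -- The first term serves the base case. The second makes the error `C b²` use at most half of the
  -- contraction `K κ a`; the other half pays for replacing `t` by `t + 1`.
  set K := max (e t₀ * (t₀ : ℝ) ^ γ) (2 * C * b ^ 2 / (κ * a))
  have hK : C * b ^ 2 ≤ K * (κ * a / 2) := by
    have h : 2 * C * b ^ 2 / (κ * a) ≤ K := le_max_right _ _
    rw [div_le_iff₀ (by positivity)] at h
    linarith
  have hK0 : 0 ≤ K := le_max_of_le_right (by positivity)
  refine ⟨K, eventually_atTop.2 ⟨t₀, fun t ht => ?_⟩⟩
  induction t, ht using Nat.le_induction with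
  | base =>
    obtain ⟨-, -, -, -, h1⟩ := ht₀ t₀ le_rfl
    have hpos : (0 : ℝ) < t₀ := by exact_mod_cast h1
    rw [Real.rpow_neg hpos.le, ← div_eq_mul_inv, le_div_iff₀ (Real.rpow_pos_of_pos hpos _)]
    exact le_max_left _ _
  | succ t ht ih =>
    obtain ⟨⟨hαa, hαb⟩, hr, hβ, hsmall, h1⟩ := ht₀ t ht
    have hpos : (0 : ℝ) < t := by exact_mod_cast h1
    set x := (t : ℝ) ^ (-γ)
    have hx : 0 < x := Real.rpow_pos_of_pos hpos _
    have hinv : (t : ℝ)⁻¹ = (t : ℝ) ^ (-(1 - γ)) * x := by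
      rw [← Real.rpow_add hpos, ← Real.rpow_neg_one]
      ring_nf
    have hstep : x * (1 - (t : ℝ)⁻¹) ≤ ((t + 1 : ℕ) : ℝ) ^ (-γ) := by
      have hq : ((t : ℝ) / (t + 1)) ^ (1 : ℝ) ≤ ((t : ℝ) / (t + 1)) ^ γ :=
        Real.rpow_le_rpow_of_exponent_ge (by positivity)
          ((div_le_one (by positivity)).2 (by linarith)) hγ1.le
      rw [Real.rpow_one, Real.div_rpow hpos.le (by positivity)] at hq
      have hq' : 1 - (t : ℝ)⁻¹ ≤ (t : ℝ) / (t + 1) := by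
        rw [le_div_iff₀ (by positivity)]
        have : (t : ℝ)⁻¹ * t = 1 := inv_mul_cancel₀ hpos.ne'
        nlinarith [inv_pos.2 hpos]
      calc x * (1 - (t : ℝ)⁻¹) ≤ x * ((t : ℝ) ^ γ / (t + 1 : ℝ) ^ γ) := by
            gcongr; exact hq'.trans hq
        _ = ((t + 1 : ℕ) : ℝ) ^ (-γ) := by
            rw [Real.rpow_neg (by positivity)]
            simp only [x, Real.rpow_neg hpos.le, Nat.cast_add, Nat.cast_one]
            have := (Real.rpow_pos_of_pos hpos γ).ne'
            field_simp
    have hαpos : 0 < α t := lt_of_lt_of_le (by positivity) hαa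
    have hA : (1 - κ * α t) * e t ≤ (1 - κ * a * x) * (K * x) := by
      have h2 : (1 - κ * α t) * e t ≤ (1 - κ * a * x) * e t := by
        refine mul_le_mul_of_nonneg_right ?_ (he t)
        nlinarith
      -- The threshold `κ a x < 1` keeps the factor nonnegative.
      exact h2.trans (mul_le_mul_of_nonneg_left ih (by linarith))
    have hB : C * α t ^ 2 ≤ K * (κ * a / 2) * x ^ 2 := by
      calc C * α t ^ 2 ≤ C * (b * x) ^ 2 := by gcongr
        _ = C * b ^ 2 * x ^ 2 := by ring
        _ ≤ _ := by gcongr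
    -- As `γ < 1`, `1 / t` is eventually below half of the contraction `κ a x`.
    have hD : K * x * (t : ℝ)⁻¹ ≤ K * (κ * a / 2) * x ^ 2 := by
      rw [hinv]
      have : K * x ^ 2 * (t : ℝ) ^ (-(1 - γ)) ≤ K * x ^ 2 * (κ * a / 2) := by gcongr
      linarith
    have hE := mul_le_mul_of_nonneg_left hstep hK0
    nlinarith

/-! ### From mean rates to almost sure rates -/

/-- For an antitone nonnegative sequence, a polynomial rate along powers of two is a rate. -/
theorem tendsto_rpow_mul_of_antitone {u : ℕ → ℝ} (hanti : ∀ m n, 1 ≤ m → m ≤ n → u n ≤ u m)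
    (hu : ∀ n, 0 ≤ u n) {q : ℝ} (hq : 0 ≤ q)
    (h : Tendsto (fun k : ℕ => ((2 : ℝ) ^ k) ^ q * u (2 ^ k)) atTop (nhds 0)) :
    Tendsto (fun n : ℕ => (n : ℝ) ^ q * u n) atTop (nhds 0) := by
  have hlog : Tendsto (Nat.log 2) atTop atTop :=
    tendsto_atTop_atTop.2 fun b => ⟨2 ^ b, fun n hn =>
      (Nat.le_log_iff_pow_le one_lt_two ((Nat.two_pow_pos b).trans_le hn).ne').2 hn⟩
  have h2 := (h.comp hlog).const_mul ((2 : ℝ) ^ q)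
  rw [mul_zero] at h2
  refine squeeze_zero' (Eventually.of_forall fun n => mul_nonneg (by positivity) (hu n)) ?_ h2
  filter_upwards [eventually_ge_atTop 1] with n hn
  have hlow : 2 ^ Nat.log 2 n ≤ n := Nat.pow_log_le_self 2 (by omega)
  have hup : (n : ℝ) ≤ 2 * 2 ^ Nat.log 2 n := by
    have := Nat.lt_pow_succ_log_self one_lt_two n
    rw [Nat.succ_eq_add_one, pow_succ'] at this
    exact_mod_cast this.le
  simp only [Function.comp_apply]
  rw [← mul_assoc, ← Real.mul_rpow (by positivity) (by positivity)]
  have := hanti _ _ Nat.one_le_two_pow hlow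
  gcongr
  exact hu n

/-- Nonnegative random variables with summable means tend to zero almost surely. -/
theorem ae_tendsto_zero_of_summable_integral {Ω : Type*} [MeasurableSpace Ω] {P : Measure Ω}
    {X : ℕ → Ω → ℝ} (hX : ∀ k, Integrable (X k) P) (hX0 : ∀ k ω, 0 ≤ X k ω)
    (hsum : Summable fun k => ∫ ω, X k ω ∂P) :
    ∀ᵐ ω ∂P, Tendsto (fun k => X k ω) atTop (nhds 0) := by
  have hmeas : ∀ k, AEMeasurable (fun ω => ENNReal.ofReal (X k ω)) P :=
    fun k => (hX k).aemeasurable.ennreal_ofReal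
  -- By Tonelli the sum has finite mean, so almost every series converges.
  have hfin : ∫⁻ ω, ∑' k, ENNReal.ofReal (X k ω) ∂P ≠ ⊤ := by
    rw [lintegral_tsum hmeas]
    simp_rw [← fun k => ofReal_integral_eq_lintegral_ofReal (hX k) (ae_of_all _ (hX0 k))]
    exact hsum.tsum_ofReal_ne_top
  filter_upwards [ae_lt_top' (AEMeasurable.tsum hmeas) hfin] with ω hω
  have h := ENNReal.tendsto_atTop_zero_of_tsum_ne_top hω.ne
  have h' := (ENNReal.tendsto_toReal ENNReal.zero_ne_top).comp h
  simpa [Function.comp_def, ENNReal.toReal_ofReal, hX0] using h'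

/-- If the means of antitone nonnegative random variables are `O(t ^ (-γ))`, then almost surely
the variables are `o(t ^ (-q))` for every `q < γ`. -/
theorem ae_tendsto_rpow_mul_of_integral_le {Ω : Type*} [MeasurableSpace Ω] {P : Measure Ω}
    {X : ℕ → Ω → ℝ} (hX : ∀ t, 1 ≤ t → Integrable (X t) P) (hX0 : ∀ t ω, 0 ≤ X t ω)
    (hanti : ∀ ω m n, 1 ≤ m → m ≤ n → X n ω ≤ X m ω) {γ K q : ℝ} (hq0 : 0 ≤ q) (hq : q < γ)
    (hK : ∀ᶠ t : ℕ in atTop, ∫ ω, X t ω ∂P ≤ K * (t : ℝ) ^ (-γ)) :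
    ∀ᵐ ω ∂P, Tendsto (fun t : ℕ => (t : ℝ) ^ q * X t ω) atTop (nhds 0) := by
  have hsum : Summable fun k : ℕ => ∫ ω, ((2 : ℝ) ^ k) ^ q * X (2 ^ k) ω ∂P := by
    have hgeo : Summable fun k : ℕ => K * ((2 : ℝ) ^ (q - γ)) ^ k :=
      (summable_geometric_of_lt_one (by positivity)
        (Real.rpow_lt_one_of_one_lt_of_neg one_lt_two (by linarith))).mul_left K
    refine hgeo.of_norm_bounded_eventually_nat ?_
    filter_upwards [(tendsto_pow_atTop_atTop_of_one_lt (one_lt_two : 1 < 2)).eventually hK]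
      with k hk
    rw [Real.norm_of_nonneg (integral_nonneg fun ω => mul_nonneg (by positivity) (hX0 _ ω)),
      integral_const_mul]
    push_cast at hk
    calc ((2 : ℝ) ^ k) ^ q * ∫ ω, X (2 ^ k) ω ∂P
        ≤ ((2 : ℝ) ^ k) ^ q * (K * ((2 : ℝ) ^ k) ^ (-γ)) := by gcongr
      _ = K * ((2 : ℝ) ^ k) ^ (q - γ) := by
          rw [sub_eq_add_neg, Real.rpow_add (by positivity)]; ring
      _ = K * ((2 : ℝ) ^ (q - γ)) ^ k := by
          rw [← Real.rpow_natCast_mul zero_le_two, mul_comm (k : ℝ),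
            Real.rpow_mul_natCast zero_le_two]
  filter_upwards [ae_tendsto_zero_of_summable_integral
    (fun k => (hX (2 ^ k) Nat.one_le_two_pow).const_mul _)
    (fun k ω => mul_nonneg (by positivity) (hX0 _ ω)) hsum] with ω hω
  exact tendsto_rpow_mul_of_antitone (hanti ω) (fun n => hX0 n ω) hq0 hω

/-! ### The algorithm -/

/-- The expected optimality gap of STP contracts by a factor `1 - κ α t`, up to a second-order
error. -/
theorem IsSTP.exists_integral_gap_le {d : ℕ} {Ω : Type*} [mΩ : MeasurableSpace Ω]
    {P : Measure Ω} [IsProbabilityMeasure P] {ℱ : Filtration ℕ mΩ}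
    {f : EuclideanSpace ℝ (Fin d) → ℝ} {L : ℝ} (hsmooth : IsLSmooth L f)
    {θstar : EuclideanSpace ℝ (Fin d)} (hmin : ∀ x, f θstar ≤ f x)
    (hconv : IsGradConvex f) (hsub : ∃ c, Bornology.IsBounded {x | f x ≤ f c})
    {D : Measure (EuclideanSpace ℝ (Fin d))} [IsProbabilityMeasure D]
    {c : ℝ} (hc : 0 < c) (hDc : ∀ v, c * ‖v‖ ≤ ∫ s, |inner ℝ v s| ∂D)
    (hDball : ∀ᵐ s ∂D, ‖s‖ ≤ 1) {θ₁ : EuclideanSpace ℝ (Fin d)} {α : ℕ → ℝ}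
    {s θ : ℕ → Ω → EuclideanSpace ℝ (Fin d)} (hSTP : IsSTP P ℱ f θ₁ α D s θ) :
    (∀ t, 1 ≤ t → Integrable (fun ω => f (θ t ω) - f θstar) P) ∧
    ∃ κ : ℝ, 0 < κ ∧ ∀ t, 1 ≤ t → ∫ ω, (f (θ (t + 1) ω) - f θstar) ∂P ≤
      (1 - κ * α t) * ∫ ω, (f (θ t ω) - f θstar) ∂P + |L| * α t ^ 2 := by
  have hfc : Continuous f := hsmooth.1.continuous
  have hgc := hsmooth.continuous_gradient
  have hθm : ∀ t, 1 ≤ t → Measurable (θ t) := fun t ht =>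
    (hSTP.measurable_point t ht).mono (ℱ.le t) le_rfl
  have hsm : ∀ t, 1 ≤ t → Measurable (s t) := fun t ht =>
    (hSTP.measurable_dir t ht).mono (ℱ.le (t + 1)) le_rfl
  have hbound : ∀ t, 1 ≤ t → ∀ ω, f (θ t ω) ≤ f θ₁ := by
    intro t ht ω
    induction t, ht using Nat.le_induction with
    | base => rw [hSTP.init]
    | succ t ht ih => exact (hSTP.step_min t ht ω _ (by simp [stpCandidates])).trans ih
  obtain ⟨R, hR, hRb⟩ := hconv.exists_norm_sub_le hfc hmin hsub (f θ₁)
  obtain ⟨G, hG⟩ := (isCompact_closedBall θstar R).exists_bound_of_continuousOn hgc.continuousOn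
  have hgb : ∀ t, 1 ≤ t → ∀ ω, ‖gradient f (θ t ω)‖ ≤ G := fun t ht ω =>
    hG _ (mem_closedBall_iff_norm.2 (hRb _ (hbound t ht ω)))
  have hint : ∀ t, 1 ≤ t → Integrable (fun ω => f (θ t ω) - f θstar) P := by
    intro t ht
    refine Integrable.of_bound (C := f θ₁ - f θstar)
      ((hfc.measurable.comp (hθm t ht)).sub_const _).aestronglyMeasurable (ae_of_all _ fun ω => ?_)
    rw [Real.norm_of_nonneg (sub_nonneg.2 (hmin _))]
    linarith [hbound t ht ω]
  refine ⟨hint, c / R, by positivity, fun t ht => ?_⟩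
  have hα := hSTP.step_pos t ht
  have hgm : Measurable fun ω => gradient f (θ t ω) := hgc.measurable.comp (hθm t ht)
  -- The gradient at `θ t` is `ℱ t`-measurable, hence independent of the new direction.
  have hind : IndepFun (fun ω => gradient f (θ t ω)) (s t) P := by
    rw [IndepFun_iff_Indep]
    exact (indep_of_indep_of_le_right (hSTP.indep_dir t ht)
      (hgc.measurable.comp (hSTP.measurable_point t ht)).comap_le).symm
  obtain ⟨hi, hle⟩ := mul_integral_norm_le_integral_abs_inner hDball hDc hgm (hsm t ht)
    (hSTP.law_dir t ht) hind (hgb t ht)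
  have hs1 : ∀ᵐ ω ∂P, ‖s t ω‖ ≤ 1 :=
    ae_of_ae_map (hsm t ht).aemeasurable (by rw [hSTP.law_dir t ht]; exact hDball)
  have hgap : ∫ ω, (f (θ t ω) - f θstar) ∂P ≤ R * ∫ ω, ‖gradient f (θ t ω)‖ ∂P := by
    rw [← integral_const_mul]
    have hgn : Integrable (fun ω => ‖gradient f (θ t ω)‖) P :=
      Integrable.of_bound (C := G) hgm.norm.aestronglyMeasurable
        (ae_of_all _ fun ω => by simpa using hgb t ht ω)
    refine integral_mono (hint t ht) (hgn.const_mul R) fun ω => ?_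
    have h1 := hconv (θ t ω) θstar
    have h2 := abs_le.1 (abs_real_inner_le_norm (gradient f (θ t ω)) (θstar - θ t ω))
    have h3 := hRb _ (hbound t ht ω)
    rw [norm_sub_rev] at h3
    have h4 := mul_le_mul_of_nonneg_left h3 (norm_nonneg (gradient f (θ t ω)))
    simp only
    linarith [h2.1]
  have hstep : ∫ ω, (f (θ (t + 1) ω) - f θstar) ∂P ≤
      ∫ ω, (f (θ t ω) - f θstar) ∂P - α t * ∫ ω, |inner ℝ (gradient f (θ t ω)) (s t ω)| ∂P
        + |L| * α t ^ 2 := by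
    have hj : Integrable (fun ω => (f (θ t ω) - f θstar)
        - α t * |inner ℝ (gradient f (θ t ω)) (s t ω)|) P := (hint t ht).sub (hi.const_mul _)
    have hr : ∫ ω, ((f (θ t ω) - f θstar) - α t * |inner ℝ (gradient f (θ t ω)) (s t ω)|
        + |L| * α t ^ 2) ∂P = ∫ ω, (f (θ t ω) - f θstar) ∂P
          - α t * ∫ ω, |inner ℝ (gradient f (θ t ω)) (s t ω)| ∂P + |L| * α t ^ 2 := by
      rw [integral_add hj (integrable_const _),
        integral_sub (hint t ht) (hi.const_mul _), integral_const_mul]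
      simp
    rw [← hr]
    refine integral_mono_ae (hint (t + 1) (by omega))
      (hj.add (integrable_const _)) ?_
    filter_upwards [hs1] with ω hω
    have := hsmooth.stp_descent hconv hα.le hω (hSTP.step_min t ht ω)
    linarith
  have hkey : c / R * ∫ ω, (f (θ t ω) - f θstar) ∂P ≤
      ∫ ω, |inner ℝ (gradient f (θ t ω)) (s t ω)| ∂P := by
    refine le_trans ?_ hle
    rw [div_mul_eq_mul_div, div_le_iff₀ hR]
    nlinarith [mul_le_mul_of_nonneg_left hgap hc.le]
  nlinarith [mul_le_mul_of_nonneg_left hkey hα.le]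

theorem theorem5 {d : ℕ} {Ω : Type*} [mΩ : MeasurableSpace Ω]
    (P : Measure Ω) [IsProbabilityMeasure P] (ℱ : Filtration ℕ mΩ)
    (f : EuclideanSpace ℝ (Fin d) → ℝ) (L : ℝ) (hsmooth : IsLSmooth L f)
    (θstar : EuclideanSpace ℝ (Fin d)) (hmin : ∀ x, f θstar ≤ f x)
    (hconv : IsGradConvex f)
    (hsub : ∃ c, Bornology.IsBounded {x | f x ≤ f c})
    (D : Measure (EuclideanSpace ℝ (Fin d))) [IsProbabilityMeasure D]
    (hD2 : Integrable (fun s => ‖s‖ ^ 2) D)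
    (hDnorm : ∃ p : Seminorm ℝ (EuclideanSpace ℝ (Fin d)), IsNorm p ∧
      ∃ μD : ℝ, 0 < μD ∧ ∀ v, μD * p v ≤ ∫ s, |inner ℝ v s| ∂D)
    (hDball : ∀ᵐ s ∂D, ‖s‖ ≤ 1)
    (θ₁ : EuclideanSpace ℝ (Fin d)) (α : ℕ → ℝ)
    (s θ : ℕ → Ω → EuclideanSpace ℝ (Fin d))
    (hSTP : IsSTP P ℱ f θ₁ α D s θ)
    (β : ℝ) (hβ : β ∈ Set.Ioo (0 : ℝ) (1 / 2))
    (hα : α =Θ[atTop] fun t : ℕ => 1 / (t : ℝ) ^ (1 - β)) :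
    ∀ ε ∈ Set.Ioo (2 * β) 1, ∀ᵐ ω ∂P,
      (fun T : ℕ => f (θ T ω) - f θstar) =o[atTop] fun T : ℕ => 1 / (T : ℝ) ^ (1 - ε) := by
  rintro ε ⟨hε, hε1⟩
  obtain ⟨hβ0, hβ2⟩ := hβ
  obtain ⟨p, hp, μ, hμ, hμp⟩ := hDnorm
  obtain ⟨c, hc, hcp⟩ := hp.exists_mul_norm_le
  have hDc : ∀ v, (μ * c) * ‖v‖ ≤ ∫ s, |inner ℝ v s| ∂D := fun v => by
    rw [mul_assoc]
    exact (mul_le_mul_of_nonneg_left (hcp v) hμ.le).trans (hμp v)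
  obtain ⟨hint, κ, hκ, hrec⟩ :=
    hSTP.exists_integral_gap_le hsmooth hmin hconv hsub (by positivity) hDc hDball
  have hαbd : ∃ a b : ℝ, 0 < a ∧ ∀ᶠ t : ℕ in atTop,
      a * (t : ℝ) ^ (-(1 - β)) ≤ α t ∧ α t ≤ b * (t : ℝ) ^ (-(1 - β)) := by
    obtain ⟨b, hb⟩ := hα.1.bound
    obtain ⟨a, ha, ha'⟩ := hα.2.exists_pos
    refine ⟨a⁻¹, b, by positivity, ?_⟩
    filter_upwards [hb, ha'.bound, eventually_ge_atTop 1] with t h1 h2 ht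
    have hx : (1 : ℝ) / (t : ℝ) ^ (1 - β) = (t : ℝ) ^ (-(1 - β)) := by
      rw [Real.rpow_neg (by positivity), one_div]
    rw [hx, Real.norm_of_nonneg (hSTP.step_pos t ht).le,
      Real.norm_of_nonneg (by positivity)] at h1 h2
    exact ⟨(inv_mul_le_iff₀ ha).2 h2, h1⟩
  obtain ⟨a, b, ha, hab⟩ := hαbd
  obtain ⟨K, hK⟩ := exists_le_mul_rpow_of_recursion
    (e := fun t => ∫ ω, (f (θ t ω) - f θstar) ∂P) hκ (abs_nonneg L) ha
    (by linarith : 0 < 1 - β) (by linarith)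
    (fun t => integral_nonneg fun ω => sub_nonneg.2 (hmin _)) hab
    ((eventually_ge_atTop 1).mono hrec)
  have hanti : ∀ ω m n, 1 ≤ m → m ≤ n → f (θ n ω) - f θstar ≤ f (θ m ω) - f θstar := by
    intro ω m n hm hmn
    induction n, hmn using Nat.le_induction with
    | base => exact le_rfl
    | succ n hn ih =>
      have := hSTP.step_min n (hm.trans hn) ω (θ n ω) (by simp [stpCandidates])
      linarith
  -- Applied with `q = 1 - ε` and `γ = 1 - β`; the condition `q < γ` is `β < ε`, which follows from
  -- `2β < ε`.
  filter_upwards [ae_tendsto_rpow_mul_of_integral_le hint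
    (fun t ω => sub_nonneg.2 (hmin (θ t ω))) hanti (by linarith : 0 ≤ 1 - ε)
    (by linarith : 1 - ε < 1 - β) hK] with ω hω
  refine (isLittleO_iff_tendsto' ?_).2 ?_
  · filter_upwards [eventually_ge_atTop 1] with T hT h0
    have : (0 : ℝ) < T := by exact_mod_cast hT
    exact absurd h0 (by positivity)
  · refine hω.congr fun T => ?_
    rw [div_div_eq_mul_div, div_one, mul_comm]
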